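/- Let $F$ be a field of characteristic zero and let $L$ be a finite-dimensional (right) Leibniz algebra over $F$, that is, a finite-dimensional vector space with a bilinear product $[\cdot,\cdot]$ satisfying $[x,[y,z]]=[[x,y],z]-[[x,z],y]$ for all $x,y,z\in L$. For subspaces $U,V$ of $L$ let $[U,V]$ be the linear span of all $[u,v]$ with $u\in U$, $v\in V$. A subalgebra $U$ is called nilpotent if $U^n=0$ for some $n\ge 1$, where $U^1=U$ and $U^{k+1}=[U^k,U]$, and solvable if $U^{(n)}=0$ for some $n\ge 1$, where $U^{(1)}=U$ and $U^{(k+1)}=[U^{(k)},U^{(k)}]$; ideals are two-sided. Let $R$ be the sum of all solvable ideals of $L$ (the radical) and $N$ the sum of all nilpotent ideals of $L$ (the nilradical). Then $R$ is the largest solvable ideal and $N$ the largest nilpotent ideal of $L$, and $[R,R]\subseteq N$; in particular, $[R,R]$ is nilpotent. Moreover, $L$ is solvable if and only if $[L,L]$ is nilpotent. -/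

import Mathlib

/-- A (right) Leibniz algebra: a nonassociative algebra, whose product `x * y` is the bracket
`[x, y]`, satisfying `[x, [y, z]] = [[x, y], z] - [[x, z], y]`. The product is not assumed to be
anticommutative. -/
class IsRightLeibniz (L : Type*) [NonUnitalNonAssocRing L] : Prop where
  leibniz : ∀ x y z : L, x * (y * z) = (x * y) * z - (x * z) * y

namespace LeibnizAlg

section

variable {F L : Type*} [Field F] [NonUnitalNonAssocRing L] [Module F L]
  [IsScalarTower F L L] [SMulCommClass F L L]

/-- The product `[U, V]` of two subspaces: the linear span of all `[u, v]`, `u ∈ U`, `v ∈ V`. -/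
def bracket (U V : Submodule F L) : Submodule F L :=
  Submodule.span F {z | ∃ u ∈ U, ∃ v ∈ V, u * v = z}

/-- A (two-sided) ideal. -/
def IsIdeal (I : Submodule F L) : Prop :=
  ∀ a ∈ I, ∀ x : L, a * x ∈ I ∧ x * a ∈ I

/-- The series `U¹ = U`, `Uᵏ⁺¹ = [Uᵏ, U]`; the index is shifted by one, so that
`lowerCentral U k` is `Uᵏ⁺¹`. -/
def lowerCentral (U : Submodule F L) : ℕ → Submodule F L
  | 0 => U
  | k + 1 => bracket (lowerCentral U k) U

/-- The series `U⁽¹⁾ = U`, `U⁽ᵏ⁺¹⁾ = [U⁽ᵏ⁾, U⁽ᵏ⁾]`; the index is shifted by one, so that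
`derived U k` is `U⁽ᵏ⁺¹⁾`. -/
def derived (U : Submodule F L) : ℕ → Submodule F L
  | 0 => U
  | k + 1 => bracket (derived U k) (derived U k)

/-- Nilpotency of a subalgebra `U` (the whole algebra is `U = ⊤`). -/
def IsNilpotent (U : Submodule F L) : Prop :=
  ∃ n : ℕ, lowerCentral U n = ⊥

/-- Solvability of a subalgebra `U` (the whole algebra is `U = ⊤`). -/
def IsSolvable (U : Submodule F L) : Prop :=
  ∃ n : ℕ, derived U n = ⊥

variable (F L)

/-- The solvable ideals of `L`. -/
def solvableIdeals : Set (Submodule F L) :=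
  {I | IsIdeal I ∧ IsSolvable I}

/-- The nilpotent ideals of `L`. -/
def nilpotentIdeals : Set (Submodule F L) :=
  {I | IsIdeal I ∧ IsNilpotent I}

/-- The radical `R(L)`: the sum of all solvable ideals. -/
def radical : Submodule F L :=
  sSup (solvableIdeals F L)

/-- The nilradical `N(L)`: the sum of all nilpotent ideals. -/
def nilradical : Submodule F L :=
  sSup (nilpotentIdeals F L)

end

end LeibnizAlg

namespace LeibnizAlg

section LieTheorem

open LieModule LieAlgebra Module
open scoped TensorProduct

/-! The Leibniz identity says that right multiplications `R_x` are derivations with `[R_a, R_b] =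
R_{ba}`. Those by elements of an ideal `I` thus form a Lie algebra of endomorphisms of `L`, solvable
when `I` is, whose derived algebra contains `R_u` for `u ∈ [I, I]`. By Lie's theorem the derived
algebra acts nilpotently on `L`, so the powers of `[I, I]`, being iterated right multiples, vanish:
`IsSolvable.isNilpotent_bracket`. This is applied to `R` and to `L`. That `R` and `N` are largest
follows from closure of both classes of ideals under binary sums and finite dimension. -/

/-- A solvable Lie algebra over an algebraically closed field of characteristic zero: elements
of the derived algebra act nilpotently on finite-dimensional modules. -/
theorem isNilpotent_toEnd_of_mem_derivedSeries_of_isAlgClosed {K g : Type*} [Field K] [CharZero K]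
    [IsAlgClosed K] [LieRing g] [LieAlgebra K g] [LieAlgebra.IsSolvable g]
    {z : g} (hz : z ∈ derivedSeries K g 1) (n : ℕ)
    (V : Type*) [AddCommGroup V] [Module K V] [LieRingModule g V] [LieModule K g V]
    [FiniteDimensional K V] (hn : finrank K V ≤ n) :
    _root_.IsNilpotent (toEnd K g V z) := by
  induction n generalizing V with
  | zero =>
    have : Subsingleton V := finrank_zero_iff.mp (Nat.le_zero.mp hn)
    exact ⟨1, LinearMap.ext fun _ ↦ Subsingleton.elim _ _⟩
  | succ n ih =>
    rcases subsingleton_or_nontrivial V with _ | _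
    · exact ⟨1, LinearMap.ext fun _ ↦ Subsingleton.elim _ _⟩
    obtain ⟨χ, hχ⟩ := exists_nontrivial_weightSpace_of_isSolvable K g V
    let W : LieSubmodule K g V := weightSpace V χ
    have hW {m : V} (hm : m ∈ W) (x : g) : ⁅x, m⁆ = χ x • m := (mem_weightSpace _ _).mp hm x
    have hWnt : Nontrivial W.toSubmodule := hχ
    obtain ⟨v, hv0⟩ := exists_ne (0 : W.toSubmodule)
    -- On a common eigenvector, commutators act by `χ x * χ y - χ y * χ x = 0`.
    have hχz : χ z = 0 := by
      suffices (derivedSeries K g 1).toSubmodule ≤ LinearMap.ker χ from this hz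
      rw [derivedSeries_def, derivedSeriesOfIdeal_succ, derivedSeriesOfIdeal_zero,
        LieSubmodule.lieIdeal_oper_eq_linear_span', Submodule.span_le]
      rintro _ ⟨x, -, y, -, rfl⟩
      have h : ⁅⁅x, y⁆, (v : V)⁆ = 0 := by
        rw [lie_lie, hW v.2, hW v.2, lie_smul, lie_smul, hW v.2, hW v.2, smul_comm, sub_self]
      rw [hW v.2, smul_eq_zero] at h
      exact h.resolve_right (by simpa using hv0)
    have hfin : finrank K (V ⧸ W) ≤ n := by
      have h1 : finrank K (V ⧸ W) + finrank K W.toSubmodule = finrank K V :=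
        Submodule.finrank_quotient_add_finrank W.toSubmodule
      have h2 : 0 < finrank K W.toSubmodule := finrank_pos
      omega
    have : FiniteDimensional K (V ⧸ W) :=
      inferInstanceAs (FiniteDimensional K (V ⧸ W.toSubmodule))
    obtain ⟨k, hk⟩ := ih (V ⧸ W) hfin
    refine ⟨k + 1, LinearMap.ext fun m ↦ ?_⟩
    have hquot (j : ℕ) : LieSubmodule.Quotient.mk (N := W) ((toEnd K g V z ^ j) m) =
        (toEnd K g (V ⧸ W) z ^ j) (LieSubmodule.Quotient.mk m) := by
      induction j with
      | zero => rfl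
      | succ j ihj =>
        rw [pow_succ', pow_succ', Module.End.mul_apply, Module.End.mul_apply, ← ihj]; rfl
    -- `z ^ k` kills `V ⧸ W`, and one more `z` kills `W` because `χ z = 0`.
    have hmem : (toEnd K g V z ^ k) m ∈ W := by
      refine (Submodule.Quotient.mk_eq_zero W.toSubmodule).mp ((hquot k).trans ?_)
      rw [hk]; rfl
    rw [pow_succ', Module.End.mul_apply, toEnd_apply_apply, hW hmem, hχz, zero_smul]; rfl

/-- The derived algebra of a solvable Lie algebra in characteristic zero acts nilpotently on
finite-dimensional modules. -/
theorem isNilpotent_derivedSeries_one {F g V : Type*} [Field F] [CharZero F]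
    [LieRing g] [LieAlgebra F g] [LieAlgebra.IsSolvable g]
    [AddCommGroup V] [Module F V] [LieRingModule g V] [LieModule F g V] [FiniteDimensional F V] :
    LieModule.IsNilpotent (derivedSeries F g 1) V := by
  rw [isNilpotent_iff_forall' (R := F)]
  rintro ⟨x, hx⟩
  let A := AlgebraicClosure F
  have : CharZero A := charZero_of_injective_algebraMap (algebraMap F A).injective
  have hx' : 1 ⊗ₜ[F] x ∈ derivedSeries A (A ⊗[F] g) 1 := by
    rw [derivedSeries_baseChange]
    exact Submodule.tmul_mem_baseChange_of_mem 1 hx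
  -- Nilpotency descends from the algebraic closure, since base change of endomorphisms is
  -- injective.
  have hinj : Function.Injective (End.baseChangeHom F A V) :=
    LinearMap.baseChangeHom_injective F V A
  have aux : (toEnd F (derivedSeries F g 1) V ⟨x, hx⟩).baseChangeHom F A V =
      (toEnd F g V x).baseChange A := rfl
  rw [← IsNilpotent.map_iff hinj, aux, ← toEnd_baseChange]
  exact isNilpotent_toEnd_of_mem_derivedSeries_of_isAlgClosed hx' _ _ le_rfl

end LieTheorem
-- Derived and lower central series of subspaces
section Series

variable {F L : Type*} [Field F] [NonUnitalNonAssocRing L] [Module F L]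
  {U V W I J : Submodule F L}

theorem mul_mem_bracket {u v : L} (hu : u ∈ U) (hv : v ∈ V) : u * v ∈ bracket U V :=
  Submodule.subset_span ⟨u, hu, v, hv, rfl⟩

theorem bracket_le : bracket U V ≤ W ↔ ∀ u ∈ U, ∀ v ∈ V, u * v ∈ W := by
  refine ⟨fun h u hu v hv ↦ h (mul_mem_bracket hu hv), fun h ↦ Submodule.span_le.mpr ?_⟩
  rintro _ ⟨u, hu, v, hv, rfl⟩
  exact h u hu v hv

theorem bracket_mono {U' V' : Submodule F L} (hU : U ≤ U') (hV : V ≤ V') :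
    bracket U V ≤ bracket U' V' :=
  bracket_le.mpr fun _ hu _ hv ↦ mul_mem_bracket (hU hu) (hV hv)

theorem derived_mono (h : U ≤ V) (n : ℕ) : derived U n ≤ derived V n := by
  induction n with
  | zero => exact h
  | succ n ih => exact bracket_mono ih ih

theorem derived_add (m n : ℕ) : derived U (m + n) = derived (derived U m) n := by
  induction n with
  | zero => rfl
  | succ n ih => rw [← add_assoc, derived, derived, ih]

theorem derived_le_lowerCentral (hU : bracket U U ≤ U) (n : ℕ) :
    derived U n ≤ lowerCentral U n ∧ derived U n ≤ U := by
  induction n with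
  | zero => exact ⟨le_rfl, le_rfl⟩
  | succ n ih => exact ⟨bracket_mono ih.1 ih.2, (bracket_mono ih.2 ih.2).trans hU⟩

theorem IsNilpotent.isSolvable (hU : bracket U U ≤ U) (h : IsNilpotent U) : IsSolvable U := by
  obtain ⟨n, hn⟩ := h
  exact ⟨n, le_bot_iff.mp ((derived_le_lowerCentral hU n).1.trans hn.le)⟩

theorem isSolvable_of_isSolvable_bracket (h : IsSolvable (bracket U U)) : IsSolvable U := by
  obtain ⟨n, hn⟩ := h
  exact ⟨1 + n, by rw [derived_add]; exact hn⟩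

theorem isIdeal_bot : IsIdeal (⊥ : Submodule F L) := by
  rintro a rfl x
  simp

theorem isIdeal_top : IsIdeal (⊤ : Submodule F L) :=
  fun _ _ _ ↦ ⟨trivial, trivial⟩

theorem IsIdeal.bracket_self_le (hI : IsIdeal I) : bracket I I ≤ I :=
  bracket_le.mpr fun a ha b _ ↦ (hI a ha b).1

theorem IsIdeal.sup (hI : IsIdeal I) (hJ : IsIdeal J) : IsIdeal (I ⊔ J) := by
  intro a ha x
  obtain ⟨b, hb, c, hc, rfl⟩ := Submodule.mem_sup.mp ha
  rw [add_mul, mul_add]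
  exact ⟨Submodule.add_mem_sup (hI b hb x).1 (hJ c hc x).1,
    Submodule.add_mem_sup (hI b hb x).2 (hJ c hc x).2⟩

/-- Modulo `J`, only products of the `I`-components survive. -/
theorem derived_sup_le (hJ : IsIdeal J) (n : ℕ) : derived (I ⊔ J) n ≤ derived I n ⊔ J := by
  induction n with
  | zero => exact le_rfl
  | succ n ih =>
    refine (bracket_mono ih ih).trans (bracket_le.mpr fun a ha b hb ↦ ?_)
    obtain ⟨a, ha', c, hc, rfl⟩ := Submodule.mem_sup.mp ha
    obtain ⟨b, hb', d, hd, rfl⟩ := Submodule.mem_sup.mp hb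
    have h : (a + c) * (b + d) = a * b + (a * d + c * (b + d)) := by
      rw [add_mul, mul_add a]; abel
    rw [h]
    exact Submodule.add_mem_sup (mul_mem_bracket ha' hb')
      (J.add_mem (hJ d hd a).2 (hJ c hc _).1)

theorem IsSolvable.sup (hJ : IsIdeal J) (h : IsSolvable I) (h' : IsSolvable J) :
    IsSolvable (I ⊔ J) := by
  obtain ⟨m, hm⟩ := h
  obtain ⟨n, hn⟩ := h'
  refine ⟨m + n, le_bot_iff.mp ?_⟩
  rw [derived_add, ← hn]
  refine derived_mono ((derived_sup_le hJ m).trans ?_) n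
  rw [hm, bot_sup_eq]

/-- A family of subspaces closed under binary suprema and containing `⊥` has its supremum as
greatest element. -/
theorem isGreatest_sSup_of_sup_mem [FiniteDimensional F L] {S : Set (Submodule F L)}
    (hbot : ⊥ ∈ S) (hsup : ∀ I ∈ S, ∀ J ∈ S, I ⊔ J ∈ S) : IsGreatest S (sSup S) := by
  obtain ⟨M, hM, hmax⟩ := wellFounded_gt.has_min S ⟨⊥, hbot⟩
  have hub : ∀ I ∈ S, I ≤ M := by
    intro I hI
    have h := hmax (M ⊔ I) (hsup M hM I hI)
    rw [left_lt_sup, not_not] at h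
    exact h
  have hgr : IsGreatest S M := ⟨hM, hub⟩
  rwa [hgr.isLUB.sSup_eq]

/-- The series `⊤, I, I², I³, …`. -/
def lowerCentralFromTop (I : Submodule F L) : ℕ → Submodule F L
  | 0 => ⊤
  | n + 1 => lowerCentral I n

theorem lowerCentralFromTop_eq_bot {m n : ℕ} (h : lowerCentral I m = ⊥) (hmn : m < n) :
    lowerCentralFromTop I n = ⊥ := by
  obtain ⟨k, rfl⟩ := Nat.exists_eq_add_of_lt hmn
  induction k with
  | zero => exact h
  | succ k ih =>
    have ih' : lowerCentral I (m + k) = ⊥ := ih (by omega)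
    refine le_bot_iff.mp (bracket_le.mpr fun a ha b _ ↦ ?_)
    rw [← add_assoc] at *
    have ha' : a ∈ lowerCentral I (m + k) := ha
    rw [ih', Submodule.mem_bot] at ha'
    rw [ha', zero_mul]
    exact zero_mem _

end Series

/-! ### Consequences of the Leibniz identity -/

section Leibniz

variable {F L : Type*} [Field F] [NonUnitalNonAssocRing L] [Module F L]
  [IsScalarTower F L L] [SMulCommClass F L L] [IsRightLeibniz L] {I J U V : Submodule F L}

/-- Right multiplications are derivations. -/
theorem mul_mul_right (x y z : L) : x * y * z = x * z * y + x * (y * z) := by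
  rw [IsRightLeibniz.leibniz x y z]; abel

theorem bracket_mul_right_mem {x : L} (hU : ∀ u ∈ U, u * x ∈ U) (hV : ∀ v ∈ V, v * x ∈ V)
    {a : L} (ha : a ∈ bracket U V) : a * x ∈ bracket U V := by
  suffices bracket U V ≤ (bracket U V).comap ((LinearMap.mul F L).flip x) from this ha
  refine bracket_le.mpr fun u hu v hv ↦ ?_
  rw [Submodule.mem_comap, LinearMap.flip_apply, LinearMap.mul_apply', mul_mul_right]
  exact add_mem (mul_mem_bracket (hU u hu) hv) (mul_mem_bracket hu (hV v hv))

/-- Left multiplication swaps the factors in one term of `x(uv) = (xu)v - (xv)u`, which is harmless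
only because both lie in the same ideal. -/
theorem IsIdeal.bracket_self (hI : IsIdeal I) : IsIdeal (bracket I I) := by
  intro a ha x
  refine ⟨bracket_mul_right_mem (fun u hu ↦ (hI u hu x).1) (fun u hu ↦ (hI u hu x).1) ha, ?_⟩
  suffices bracket I I ≤ (bracket I I).comap (LinearMap.mul F L x) from this ha
  refine bracket_le.mpr fun u hu v hv ↦ ?_
  rw [Submodule.mem_comap, LinearMap.mul_apply', IsRightLeibniz.leibniz]
  exact sub_mem (mul_mem_bracket (hI u hu x).2 hv) (mul_mem_bracket (hI v hv x).2 hu)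

theorem lowerCentral_mul_right_mem (hI : IsIdeal I) (x : L) (n : ℕ) :
    ∀ a ∈ lowerCentral I n, a * x ∈ lowerCentral I n := by
  induction n with
  | zero => exact fun a ha ↦ (hI a ha x).1
  | succ n ih => exact fun a ha ↦ bracket_mul_right_mem ih (fun u hu ↦ (hI u hu x).1) ha

theorem lowerCentralFromTop_mul_mem (hI : IsIdeal I) {n : ℕ} {a u : L}
    (ha : a ∈ lowerCentralFromTop I n) :
    a * u ∈ lowerCentralFromTop I n ∧ (u ∈ I → a * u ∈ lowerCentralFromTop I (n + 1)) := by
  cases n with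
  | zero => exact ⟨trivial, fun hu ↦ (hI u hu a).2⟩
  | succ n => exact ⟨lowerCentral_mul_right_mem hI u n a ha, fun hu ↦ mul_mem_bracket ha hu⟩

/-- Each new right factor from `I` raises the `I`-index and preserves the `J`-index, as powers of an
ideal are stable under right multiplication; symmetrically for `J`. -/
theorem lowerCentral_sup_le (hI : IsIdeal I) (hJ : IsIdeal J) (n : ℕ) :
    lowerCentral (I ⊔ J) n ≤ ⨆ p : {p : ℕ × ℕ // p.1 + p.2 = n + 1},
      lowerCentralFromTop I p.1.1 ⊓ lowerCentralFromTop J p.1.2 := by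
  induction n with
  | zero =>
    refine sup_le ?_ ?_
    · exact le_iSup_of_le ⟨(1, 0), rfl⟩ (le_inf le_rfl le_top)
    · exact le_iSup_of_le ⟨(0, 1), rfl⟩ (le_inf le_top le_rfl)
  | succ n ih =>
    refine bracket_le.mpr fun a ha u hu ↦ ?_
    suffices (⨆ p : {p : ℕ × ℕ // p.1 + p.2 = n + 1},
        lowerCentralFromTop I p.1.1 ⊓ lowerCentralFromTop J p.1.2) ≤
        (⨆ p : {p : ℕ × ℕ // p.1 + p.2 = n + 1 + 1}, lowerCentralFromTop I p.1.1 ⊓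
          lowerCentralFromTop J p.1.2).comap ((LinearMap.mul F L).flip u) from this (ih ha)
    refine iSup_le ?_
    rintro ⟨⟨i, j⟩, hij : i + j = n + 1⟩ b ⟨hbI, hbJ⟩
    obtain ⟨v, hv, w, hw, rfl⟩ := Submodule.mem_sup.mp hu
    rw [Submodule.mem_comap, LinearMap.flip_apply, LinearMap.mul_apply', mul_add]
    refine add_mem ?_ ?_
    · exact Submodule.mem_iSup_of_mem ⟨(i + 1, j), by simp only; omega⟩
        ⟨(lowerCentralFromTop_mul_mem hI hbI).2 hv, (lowerCentralFromTop_mul_mem hJ hbJ).1⟩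
    · exact Submodule.mem_iSup_of_mem ⟨(i, j + 1), by simp only; omega⟩
        ⟨(lowerCentralFromTop_mul_mem hI hbI).1, (lowerCentralFromTop_mul_mem hJ hbJ).2 hw⟩

theorem IsNilpotent.sup (hI : IsIdeal I) (hJ : IsIdeal J) (h : IsNilpotent I)
    (h' : IsNilpotent J) : IsNilpotent (I ⊔ J) := by
  obtain ⟨m, hm⟩ := h
  obtain ⟨n, hn⟩ := h'
  refine ⟨m + n, le_bot_iff.mp ((lowerCentral_sup_le hI hJ _).trans (iSup_le ?_))⟩
  rintro ⟨⟨i, j⟩, hij : i + j = m + n + 1⟩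
  -- As `i + j = m + n + 1`, either `i > m` or `j > n`.
  rcases lt_or_ge m i with hi | hi
  · exact inf_le_left.trans (lowerCentralFromTop_eq_bot hm hi).le
  · have hj : n < j := by omega
    exact inf_le_right.trans (lowerCentralFromTop_eq_bot hn hj).le

attribute [local instance 100] LieRing.ofAssociativeRing

/-- The Lie algebra of right multiplications by the elements of an ideal. -/
def rightMul (hI : IsIdeal I) : LieSubalgebra F (Module.End F L) where
  toSubmodule := I.map (LinearMap.mul F L).flip
  lie_mem' := by
    rintro _ _ ⟨a, ha, rfl⟩ ⟨b, hb, rfl⟩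
    refine ⟨b * a, (hI b hb a).1, LinearMap.ext fun x ↦ ?_⟩
    exact IsRightLeibniz.leibniz x b a

theorem derivedSeries_rightMul_le (hI : IsIdeal I) (n : ℕ) :
    (LieAlgebra.derivedSeries F (rightMul hI) n).toSubmodule.map (rightMul hI).toSubmodule.subtype ≤
      (derived I n).map (LinearMap.mul F L).flip := by
  induction n with
  | zero =>
    rintro _ ⟨x, -, rfl⟩
    exact x.2
  | succ n ih =>
    rw [LieAlgebra.derivedSeries_def, LieAlgebra.derivedSeriesOfIdeal_succ,
      LieSubmodule.lieIdeal_oper_eq_linear_span', Submodule.map_span_le]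
    rintro _ ⟨x, hx, y, hy, rfl⟩
    obtain ⟨a, ha, hax⟩ := ih ⟨x, hx, rfl⟩
    obtain ⟨b, hb, hby⟩ := ih ⟨y, hy, rfl⟩
    refine ⟨b * a, mul_mem_bracket hb ha, LinearMap.ext fun z ↦ ?_⟩
    have h : (rightMul hI).toSubmodule.subtype ⁅x, y⁆ =
      ⁅(LinearMap.mul F L).flip a, (LinearMap.mul F L).flip b⁆ := by rw [hax, hby]; rfl
    rw [h]
    exact IsRightLeibniz.leibniz z b a

theorem isSolvable_rightMul (hI : IsIdeal I) (h : IsSolvable I) :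
    LieAlgebra.IsSolvable (rightMul hI) := by
  obtain ⟨n, hn⟩ := h
  refine LieAlgebra.IsSolvable.mk (R := F) (k := n) ((LieSubmodule.eq_bot_iff _).mpr fun x hx ↦ ?_)
  have h := derivedSeries_rightMul_le hI n ⟨x, hx, rfl⟩
  rw [hn, Submodule.map_bot, Submodule.mem_bot] at h
  exact Subtype.ext h

theorem exists_mem_derivedSeries_rightMul (hI : IsIdeal I) {u : L} (hu : u ∈ bracket I I) :
    ∃ x ∈ LieAlgebra.derivedSeries F (rightMul hI) 1,
      (x : Module.End F L) = (LinearMap.mul F L).flip u := by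
  suffices bracket I I ≤
      ((LieAlgebra.derivedSeries F (rightMul hI) 1).toSubmodule.map
        (rightMul hI).toSubmodule.subtype).comap (LinearMap.mul F L).flip from this hu
  refine bracket_le.mpr fun a ha b hb ↦ ?_
  let x : rightMul hI := ⟨(LinearMap.mul F L).flip b, b, hb, rfl⟩
  let y : rightMul hI := ⟨(LinearMap.mul F L).flip a, a, ha, rfl⟩
  refine ⟨⁅x, y⁆, LieSubmodule.lie_mem_lie (LieSubmodule.mem_top x) (LieSubmodule.mem_top y),
    LinearMap.ext fun z ↦ ?_⟩
  exact (IsRightLeibniz.leibniz z a b).symm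

theorem IsSolvable.isNilpotent_bracket [CharZero F] [FiniteDimensional F L] (hI : IsIdeal I)
    (h : IsSolvable I) : IsNilpotent (bracket I I) := by
  have := isSolvable_rightMul hI h
  obtain ⟨n, hn⟩ := (LieModule.isNilpotent_iff F _ _).mp
    (isNilpotent_derivedSeries_one (F := F) (g := rightMul hI) (V := L))
  refine ⟨n, le_bot_iff.mp ?_⟩
  suffices ∀ k, lowerCentral (bracket I I) k ≤ (LieModule.lowerCentralSeries F
      (LieAlgebra.derivedSeries F (rightMul hI) 1) L k).toSubmodule by
    refine (this n).trans ?_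
    rw [hn]; rfl
  intro k
  induction k with
  | zero => exact fun _ _ ↦ trivial
  | succ k ih =>
    refine bracket_le.mpr fun a ha u hu ↦ ?_
    obtain ⟨x, hx, hxu⟩ := exists_mem_derivedSeries_rightMul hI hu
    -- Right multiplication by `u` is the action of an element of the derived algebra, so it moves
    -- one step down the module's lower central series.
    have hax : a * u = ⁅(⟨x, hx⟩ : LieAlgebra.derivedSeries F (rightMul hI) 1), a⁆ :=
      (LinearMap.congr_fun hxu a).symm
    rw [hax, LieModule.lowerCentralSeries_succ]
    exact LieSubmodule.lie_mem_lie (LieSubmodule.mem_top _) (ih ha)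

end Leibniz

end LeibnizAlg
/-- The first two conjuncts say that the radical and the nilradical really are the largest
solvable ideal and the largest nilpotent ideal of `L`. -/
theorem mainTheorem3 {F L : Type*} [Field F] [CharZero F] [NonUnitalNonAssocRing L] [Module F L]
    [IsScalarTower F L L] [SMulCommClass F L L] [FiniteDimensional F L] [IsRightLeibniz L] :
    IsGreatest (LeibnizAlg.solvableIdeals F L) (LeibnizAlg.radical F L) ∧
    IsGreatest (LeibnizAlg.nilpotentIdeals F L) (LeibnizAlg.nilradical F L) ∧
    LeibnizAlg.bracket (LeibnizAlg.radical F L) (LeibnizAlg.radical F L) ≤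
      LeibnizAlg.nilradical F L ∧
    LeibnizAlg.IsNilpotent
      (LeibnizAlg.bracket (LeibnizAlg.radical F L) (LeibnizAlg.radical F L)) ∧
    (LeibnizAlg.IsSolvable (⊤ : Submodule F L) ↔
      LeibnizAlg.IsNilpotent (LeibnizAlg.bracket (⊤ : Submodule F L) ⊤)) := by
  have hR : IsGreatest (LeibnizAlg.solvableIdeals F L) (LeibnizAlg.radical F L) :=
    LeibnizAlg.isGreatest_sSup_of_sup_mem ⟨LeibnizAlg.isIdeal_bot, 0, rfl⟩
      fun _ hI _ hJ ↦ ⟨hI.1.sup hJ.1, hI.2.sup hJ.1 hJ.2⟩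
  have hN : IsGreatest (LeibnizAlg.nilpotentIdeals F L) (LeibnizAlg.nilradical F L) :=
    LeibnizAlg.isGreatest_sSup_of_sup_mem ⟨LeibnizAlg.isIdeal_bot, 0, rfl⟩
      fun _ hI _ hJ ↦ ⟨hI.1.sup hJ.1, hI.2.sup hI.1 hJ.1 hJ.2⟩
  have hRR := hR.1.2.isNilpotent_bracket hR.1.1
  refine ⟨hR, hN, hN.2 ⟨hR.1.1.bracket_self, hRR⟩, hRR,
    fun h ↦ h.isNilpotent_bracket LeibnizAlg.isIdeal_top, fun h ↦ ?_⟩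
  exact LeibnizAlg.isSolvable_of_isSolvable_bracket
    (h.isSolvable LeibnizAlg.isIdeal_top.bracket_self.bracket_self_le)
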